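/- Let $g>0$, $\alpha>0$ and $\chi\in(0,1)$. There exist constants $c_1,c_2>0$, depending only on $g$, $\alpha$ and $\chi$, such that the following holds for every standard two-sided Brownian motion $(W_t)_{t\in\mathbb R}$ (with $W_0=0$ and continuous paths almost surely) on a probability space $(\Omega,\mathcal F,\mathbb P)$. For $\varepsilon\in[0,2g]$ and $\sigma=\sqrt{\varepsilon}$ put $$M_\sigma(t,\omega)=\int_{-\infty}^0 e^{g s+\sigma\,(W_{s+t}(\omega)-W_t(\omega))}\,\mathrm ds ,$$ $$f_\varepsilon(t,s,\omega)=-2\varepsilon\,(t-s)-2\sigma\,\bigl(W_t(\omega)-W_s(\omega)\bigr),$$ and let $a_\varepsilon$ be the explicit bifurcated random steady state of the non-Markovian pitchfork normal form $\mathrm dX=(\varepsilon X-\alpha M_\sigma(t,\omega)X^3)\,\mathrm dt+\sigma X\circ\mathrm dW_t$, that is, the process defined by $$a_\varepsilon(t,\omega)=\Bigl(2\alpha\int_{-\infty}^t M_\sigma(s,\omega)\,e^{f_\varepsilon(t,s,\omega)}\,\mathrm ds\Bigr)^{-1/2},$$ where $a_\varepsilon(t,\omega)=0$ if the integral is $+\infty$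 (as happens for $\varepsilon=0$). Then $$\mathbb P\bigl(c_1\sqrt{\varepsilon}\le a_\varepsilon(t)\le c_2\sqrt{\varepsilon}\bigr)\ge 1-\chi\qquad\text{for all }\varepsilon\in[0,2g]\text{ and all }t\ge 0 .$$ -/

import Mathlib

open MeasureTheory ProbabilityTheory Set
open scoped ENNReal NNReal

universe u

noncomputable section

/-- A standard two-sided Brownian motion `(W t)`, `t ∈ ℝ`, under `P`: it starts from `0`, its
increments over consecutive time intervals of the real line are independent,
`W t - W s ∼ N(0, t - s)` for `s ≤ t`, and almost all paths are continuous. -/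
structure IsTwoSidedBrownianMotion {Ω : Type u} [MeasurableSpace Ω] (W : ℝ → Ω → ℝ)
    (P : Measure Ω) : Prop where
  zero_at_zero : ∀ᵐ ω ∂P, W 0 ω = 0
  indep_increments : HasIndepIncrements W P
  law_increment : ∀ s t : ℝ, s ≤ t →
    HasLaw (fun ω => W t ω - W s ω) (gaussianReal 0 (t - s).toNNReal) P
  continuous_paths : ∀ᵐ ω ∂P, Continuous fun t => W t ω

/-- `M_σ(t, ω) = ∫_{-∞}^0 exp (g s + σ (W_{s+t}(ω) - W_t(ω))) ds`, an integral of a positive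
function, with values in `[0, ∞]`. -/
def memoryTerm {Ω : Type u} (W : ℝ → Ω → ℝ) (g σ t : ℝ) (ω : Ω) : ℝ≥0∞ :=
  ∫⁻ s in Iic (0 : ℝ), ENNReal.ofReal (Real.exp (g * s + σ * (W (s + t) ω - W t ω)))

/-- `f_ε(t, s, ω) = -2 ε (t - s) - 2 σ (W_t(ω) - W_s(ω))`. -/
def forcingExponent {Ω : Type u} (W : ℝ → Ω → ℝ) (ε σ t s : ℝ) (ω : Ω) : ℝ :=
  -2 * ε * (t - s) - 2 * σ * (W t ω - W s ω)

/-- The explicit random steady state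
`a_ε(t, ω) = 1 / √(2 α ∫_{-∞}^t M_σ(s, ω) exp (f_ε(t, s, ω)) ds)`,
computed in `[0, ∞]` with the conventions `1 / ∞ = 0` and `1 / 0 = ∞`. -/
def randomSteadyState {Ω : Type u} (W : ℝ → Ω → ℝ) (g α ε σ t : ℝ) (ω : Ω) : ℝ≥0∞ :=
  1 / (ENNReal.ofReal (2 * α) *
    ∫⁻ s in Iic t, memoryTerm W g σ s ω *
      ENNReal.ofReal (Real.exp (forcingExponent W ε σ t s ω))) ^ (1 / 2 : ℝ)

end

/-! Put y = √ε W. Since a_ε is (2αI)^(-1/2), with I the defining integral, it suffices to trap εI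
between positive constants with probability at least 1 - χ. An increment of y over time u has
variance εu, so at time scale 1/ε everything looks the same for all ε and t. But εI has no uniform
moment bound: the mean of exp(-2ε(t-s) - 2(y_t - y_s)) is 1 for every s.

Instead a functional `pathControl` is used whose mean is at most an absolute constant C
(`lintegral_pathControl_le`). By Markov's inequality it stays below q = C/χ + 1 outside an event of
probability at most χ. There, deterministic path estimates bound εI above
(`ofReal_mul_pathIntegral_le`) and below (`le_ofReal_mul_pathIntegral`). Both start from the
symmetric form of the exponent, -(y_t - y_s) - (y_t - y_{r+s}), which lets elementary inequalities
separate the two times. -/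

/-- The exponential with values in `[0, ∞]`. -/
noncomputable def expENN (x : ℝ) : ℝ≥0∞ := ENNReal.ofReal (Real.exp x)

lemma expENN_add (x y : ℝ) : expENN (x + y) = expENN x * expENN y := by
  rw [expENN, Real.exp_add, ENNReal.ofReal_mul (Real.exp_pos x).le]; rfl

lemma expENN_pow (x : ℝ) (n : ℕ) : expENN x ^ n = expENN (n * x) := by
  rw [expENN, ← ENNReal.ofReal_pow (Real.exp_pos x).le, ← Real.exp_nat_mul]; rfl

lemma expENN_mono {x y : ℝ} (h : x ≤ y) : expENN x ≤ expENN y :=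
  ENNReal.ofReal_le_ofReal (Real.exp_le_exp.2 h)

lemma expENN_zero : expENN 0 = 1 := by simp [expENN]

lemma expENN_ne_top (x : ℝ) : expENN x ≠ ∞ := ENNReal.ofReal_ne_top

@[fun_prop]
lemma measurable_expENN : Measurable expENN := by unfold expENN; fun_prop

lemma expENN_neg_add_le (p q : ℝ) :
    expENN (-(p + q)) ≤ expENN (-2 * p) + expENN (-2 * q) := by
  rw [expENN, expENN, expENN, ← ENNReal.ofReal_add (Real.exp_pos _).le (Real.exp_pos _).le]
  refine ENNReal.ofReal_le_ofReal ?_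
  have hp : Real.exp (-2 * p) = Real.exp (-p) ^ 2 := by rw [← Real.exp_nat_mul]; ring_nf
  have hq : Real.exp (-2 * q) = Real.exp (-q) ^ 2 := by rw [← Real.exp_nat_mul]; ring_nf
  rw [hp, hq, neg_add, Real.exp_add]
  nlinarith [sq_nonneg (Real.exp (-p) - Real.exp (-q)), sq_nonneg (Real.exp (-p)),
    sq_nonneg (Real.exp (-q))]

/-- With a = e^p and b = e^q, expand (l - ab)² / (ab) ≥ 0 and use ab ≤ a² + b². This turns upper
bounds on e^(2p), e^(2q) into a lower bound on e^(-(p+q)) that survives integration. -/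
lemma ofReal_two_mul_le_expENN (l p q : ℝ) :
    ENNReal.ofReal (2 * l) ≤
      ENNReal.ofReal (l ^ 2) * expENN (-(p + q)) + (expENN (2 * p) + expENN (2 * q)) := by
  rw [expENN, expENN, expENN, ← ENNReal.ofReal_add (Real.exp_pos _).le (Real.exp_pos _).le,
    ← ENNReal.ofReal_mul (by positivity), ← ENNReal.ofReal_add (by positivity) (by positivity)]
  refine ENNReal.ofReal_le_ofReal ?_
  have hp : Real.exp (2 * p) = Real.exp p ^ 2 := by rw [← Real.exp_nat_mul]; ring_nf
  have hq : Real.exp (2 * q) = Real.exp q ^ 2 := by rw [← Real.exp_nat_mul]; ring_nf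
  rw [hp, hq, neg_add, Real.exp_add, Real.exp_neg, Real.exp_neg]
  have ha := Real.exp_pos p
  have hb := Real.exp_pos q
  set a := Real.exp p
  set b := Real.exp q
  have h1 : 2 * l ≤ l ^ 2 * (a⁻¹ * b⁻¹) + a * b := by
    have : l ^ 2 * (a⁻¹ * b⁻¹) + a * b - 2 * l = (l - a * b) ^ 2 * (a⁻¹ * b⁻¹) := by
      field_simp; ring
    have : 0 ≤ (l - a * b) ^ 2 * (a⁻¹ * b⁻¹) := by positivity
    linarith
  nlinarith [sq_nonneg (a - b), sq_nonneg a, sq_nonneg b]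

lemma tsum_expENN_neg_mul_ne_top {c : ℝ} (hc : 0 < c) :
    ∑' k : ℕ, expENN (-(c * k)) ≠ ∞ := by
  refine Summable.tsum_ofReal_ne_top ?_
  have : (fun k : ℕ => Real.exp (-(c * k))) = fun k : ℕ => Real.exp (-c) ^ k := by
    ext k; rw [← Real.exp_nat_mul]; ring_nf
  rw [this]
  exact summable_geometric_of_lt_one (Real.exp_pos _).le (by simpa using hc)

lemma setLIntegral_Iic_expENN_mul {c : ℝ} (hc : 0 < c) :
    ∫⁻ r in Iic (0 : ℝ), expENN (c * r) = ENNReal.ofReal (1 / c) := by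
  unfold expENN
  rw [← ofReal_integral_eq_lintegral_ofReal (integrableOn_exp_mul_Iic hc 0)
    (ae_of_all _ fun _ => (Real.exp_pos _).le), integral_exp_mul_Iic hc]
  simp

/-! ### Deterministic estimates along a continuous path. -/

/-- The integral in the definition of the random steady state, along a scaled path `y = σ W(ω)`. -/
noncomputable def pathIntegral (y : ℝ → ℝ) (g ε t : ℝ) : ℝ≥0∞ :=
  ∫⁻ s in Iic t, (∫⁻ r in Iic (0 : ℝ), expENN (g * r + (y (r + s) - y s))) *
    expENN (-2 * ε * (t - s) - 2 * (y t - y s))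

lemma pathIntegral_eq_lintegral_lintegral {y : ℝ → ℝ} (hy : Continuous y) (g ε t : ℝ) :
    pathIntegral y g ε t = ∫⁻ s in Iic t, ∫⁻ r in Iic (0 : ℝ),
      expENN (g * r - 2 * ε * (t - s) + -((y t - y s) + (y t - y (r + s)))) := by
  have hym := hy.measurable
  unfold pathIntegral
  refine lintegral_congr fun s => ?_
  rw [← lintegral_mul_const _ (by fun_prop)]
  refine lintegral_congr fun r => ?_
  rw [← expENN_add]; congr 1; ring

lemma pathIntegral_le {y : ℝ → ℝ} (hy : Continuous y) {g ε : ℝ} (hg : 0 < g) (hε : 0 < ε)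
    (hεg : ε ≤ 2 * g) (t : ℝ) :
    pathIntegral y g ε t ≤ ENNReal.ofReal (4 / g) *
      ∫⁻ s in Iic t, expENN (-(ε / 4) * (t - s) + -2 * (y t - y s)) := by
  have hym := hy.measurable
  set φ : ℝ → ℝ≥0∞ := fun s => expENN (-(ε / 4) * (t - s) + -2 * (y t - y s)) with hφ
  have hφm : Measurable φ := by fun_prop
  have hc : ∫⁻ r in Iic (0 : ℝ), expENN (g / 2 * r) = ENNReal.ofReal (2 / g) := by
    rw [setLIntegral_Iic_expENN_mul (by positivity)]; congr 1; field_simp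
  have hpt : ∀ s ∈ Iic t, ∀ r ∈ Iic (0 : ℝ),
      expENN (g * r - 2 * ε * (t - s) + -((y t - y s) + (y t - y (r + s)))) ≤
        expENN (g / 2 * r) * φ s + expENN (g / 2 * r) * φ (r + s) := by
    intro s hs r hr
    simp only [mem_Iic] at hs hr
    rw [expENN_add, ← mul_add]
    have h1 : φ s = expENN (-(ε / 4) * (t - s)) * expENN (-2 * (y t - y s)) := expENN_add _ _
    have h2 : φ (r + s) = expENN (-(ε / 4) * (t - (r + s))) * expENN (-2 * (y t - y (r + s))) :=
      expENN_add _ _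
    calc _ ≤ (expENN (g / 2 * r) * expENN (-(ε / 4) * (t - (r + s)))) *
          (expENN (-2 * (y t - y s)) + expENN (-2 * (y t - y (r + s)))) := by
          refine mul_le_mul' ?_ (expENN_neg_add_le _ _)
          rw [← expENN_add]
          -- Half of the memory decay g is kept for the r-integral; the other half pays for moving
          -- the discount from s to r + s, since ε/4 ≤ g/2.
          refine expENN_mono ?_
          nlinarith
      _ ≤ _ := by
          rw [mul_assoc, mul_add]
          refine mul_le_mul_right (add_le_add ?_ h2.ge) _
          rw [h1]
          refine mul_le_mul_left (expENN_mono ?_) _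
          nlinarith
  rw [pathIntegral_eq_lintegral_lintegral hy]
  have hA : ∫⁻ s in Iic t, ∫⁻ r in Iic (0 : ℝ), expENN (g / 2 * r) * φ s =
      ENNReal.ofReal (2 / g) * ∫⁻ s in Iic t, φ s := by
    rw [← lintegral_const_mul _ hφm]
    refine lintegral_congr fun s => ?_
    rw [lintegral_mul_const _ (by fun_prop), hc]
  have hB : ∫⁻ s in Iic t, ∫⁻ r in Iic (0 : ℝ), expENN (g / 2 * r) * φ (r + s) ≤
      ENNReal.ofReal (2 / g) * ∫⁻ s in Iic t, φ s := by
    rw [lintegral_lintegral_swap (by fun_prop), ← hc, ← lintegral_mul_const _ (by fun_prop)]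
    refine setLIntegral_mono' measurableSet_Iic fun r hr => ?_
    rw [lintegral_const_mul _ (by fun_prop)]
    refine mul_le_mul_right ?_ _
    -- Translation by r ≤ 0 maps times before t to times before t.
    rw [← lintegral_indicator measurableSet_Iic, ← lintegral_indicator measurableSet_Iic,
      ← lintegral_add_left_eq_self ((Iic t).indicator φ) r]
    refine lintegral_mono fun s => ?_
    by_cases hs : s ∈ Iic t
    · have : r + s ∈ Iic t := by
        simp only [mem_Iic] at hs hr ⊢; linarith
      rw [indicator_of_mem hs, indicator_of_mem this]
    · rw [indicator_of_notMem hs]; exact zero_le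
  calc _ ≤ ∫⁻ s in Iic t, ∫⁻ r in Iic (0 : ℝ),
        (expENN (g / 2 * r) * φ s + expENN (g / 2 * r) * φ (r + s)) :=
        setLIntegral_mono' measurableSet_Iic fun s hs =>
          setLIntegral_mono' measurableSet_Iic fun r hr => hpt s hs r hr
    _ = (∫⁻ s in Iic t, ∫⁻ r in Iic (0 : ℝ), expENN (g / 2 * r) * φ s) +
        ∫⁻ s in Iic t, ∫⁻ r in Iic (0 : ℝ), expENN (g / 2 * r) * φ (r + s) := by
        rw [← lintegral_add_left]
        · refine lintegral_congr fun s => ?_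
          rw [lintegral_add_left (by fun_prop)]
        · exact Measurable.lintegral_prod_right (by fun_prop)
    _ ≤ ENNReal.ofReal (2 / g) * (∫⁻ s in Iic t, φ s) +
        ENNReal.ofReal (2 / g) * ∫⁻ s in Iic t, φ s := add_le_add hA.le hB
    _ = _ := by
        rw [← add_mul, ← ENNReal.ofReal_add (by positivity) (by positivity)]
        congr 2; ring

/-- A functional of the path `y` before time `t`, at time scale `1 / ε`, that controls
`ε * pathIntegral y g ε t` from both sides. -/
noncomputable def pathControl (y : ℝ → ℝ) (ε t : ℝ) : ℝ≥0∞ :=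
  ENNReal.ofReal ε * (∫⁻ s in Ioc (t - 3 / ε) t, expENN (2 * (y t - y s))) +
    ∑' k : ℕ, (ENNReal.ofReal ε * expENN (-(1 / 16 * k)) *
        (∫⁻ s in Ioc (t - (k + 1) / ε) (t - k / ε), expENN (-2 * (y (t - k / ε) - y s))) +
      expENN (-(1 / 1024 * k)) * expENN (-(1 / 32) * (y t - y (t - k / ε))))

lemma Iic_subset_iUnion_Ioc {ε : ℝ} (hε : 0 < ε) (t : ℝ) :
    Iic t ⊆ ⋃ k : ℕ, Ioc (t - (k + 1) / ε) (t - k / ε) := by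
  intro s hs
  simp only [mem_Iic] at hs
  have h0 : 0 ≤ (t - s) * ε := mul_nonneg (by linarith) hε.le
  refine mem_iUnion.2 ⟨⌊(t - s) * ε⌋₊, ?_, ?_⟩
  · have := Nat.lt_floor_add_one ((t - s) * ε)
    have := (lt_div_iff₀ hε).2 this
    linarith
  · have := (div_le_iff₀ hε).2 (Nat.floor_le h0)
    linarith

/-- Cut the past into blocks of length 1/ε. The increment from t back to block k has too large an
exponential moment at exponent 2, so `pathControl` contains it at exponent 1/32, and the 64th power
restores the 2. -/
lemma ofReal_mul_setLIntegral_le {y : ℝ → ℝ} (hy : Continuous y) {ε : ℝ} (hε : 0 < ε) (t : ℝ)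
    {Q : ℝ≥0∞} (hQ : pathControl y ε t ≤ Q) :
    ENNReal.ofReal ε * ∫⁻ s in Iic t, expENN (-(ε / 4) * (t - s) + -2 * (y t - y s)) ≤
      Q ^ 65 * ∑' k : ℕ, expENN (-(1 / 8 * k)) := by
  have hym := hy.measurable
  have hk := fun k : ℕ => (ENNReal.le_tsum k).trans (le_add_self.trans hQ)
  calc _ ≤ ENNReal.ofReal ε * ∑' k : ℕ, ∫⁻ s in Ioc (t - (k + 1) / ε) (t - k / ε),
        expENN (-(ε / 4) * (t - s) + -2 * (y t - y s)) := by
        refine mul_le_mul_right ?_ _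
        exact (lintegral_mono_set (Iic_subset_iUnion_Ioc hε t)).trans (lintegral_iUnion_le _ _)
    _ ≤ ∑' k : ℕ, Q ^ 65 * expENN (-(1 / 8 * k)) := by
        rw [← ENNReal.tsum_mul_left]
        refine ENNReal.tsum_le_tsum fun k => ?_
        have h1 := le_self_add.trans (hk k)
        have h2 := pow_le_pow_left₀ zero_le (le_add_self.trans (hk k)) 64
        rw [← expENN_add, expENN_pow] at h2
        calc _ ≤ ENNReal.ofReal ε * ∫⁻ s in Ioc (t - (k + 1) / ε) (t - k / ε),
              expENN (-(1 / 4 * k) + -2 * (y t - y (t - k / ε))) *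
                expENN (-2 * (y (t - k / ε) - y s)) := by
              refine mul_le_mul_right (setLIntegral_mono' measurableSet_Ioc fun s hs => ?_) _
              rw [← expENN_add]
              refine expENN_mono ?_
              have : (k : ℝ) ≤ ε * (t - s) := by
                have := hs.2
                have h3 : k / ε ≤ t - s := by linarith
                rw [div_le_iff₀ hε] at h3; linarith
              linarith
          _ = expENN (-(1 / 8 * k)) * (expENN ((64 : ℕ) * (-(1 / 1024 * k) +
                -(1 / 32) * (y t - y (t - k / ε)))) * (ENNReal.ofReal ε * expENN (-(1 / 16 * k)) *
                (∫⁻ s in Ioc (t - (k + 1) / ε) (t - k / ε),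
                  expENN (-2 * (y (t - k / ε) - y s))))) := by
              rw [lintegral_const_mul _ (by fun_prop)]
              -- The decay is shared as 1/4 = 1/8 + 64/1024 + 1/16: for the final sum, the 64th
              -- power, and the integral over the block.
              have : expENN (-(1 / 4 * k) + -2 * (y t - y (t - k / ε))) = expENN (-(1 / 8 * k)) *
                  expENN ((64 : ℕ) * (-(1 / 1024 * k) +
                -(1 / 32) * (y t - y (t - k / ε)))) * expENN (-(1 / 16 * k)) := by
                rw [← expENN_add, ← expENN_add]; congr 1; push_cast; ring
              rw [this]; ring
          _ ≤ expENN (-(1 / 8 * k)) * (Q ^ 64 * Q) :=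
              mul_le_mul_right (mul_le_mul' h2 h1) _
          _ = _ := by ring
    _ = _ := ENNReal.tsum_mul_left

lemma ofReal_mul_pathIntegral_le {y : ℝ → ℝ} (hy : Continuous y) {g ε : ℝ} (hg : 0 < g)
    (hε : 0 < ε) (hεg : ε ≤ 2 * g) (t : ℝ) {Q : ℝ≥0∞} (hQ : pathControl y ε t ≤ Q) :
    ENNReal.ofReal ε * pathIntegral y g ε t ≤
      ENNReal.ofReal (4 / g) * (Q ^ 65 * ∑' k : ℕ, expENN (-(1 / 8 * k))) := by
  refine (mul_le_mul_right (pathIntegral_le hy hg hε hεg t) _).trans ?_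
  rw [mul_left_comm]
  exact mul_le_mul_right (ofReal_mul_setLIntegral_le hy hε t hQ) _

lemma le_ofReal_mul_pathIntegral {y : ℝ → ℝ} (hy : Continuous y) {g ε : ℝ} (hg : 0 < g)
    (hε : 0 < ε) (hεg : ε ≤ 2 * g) (t : ℝ) {q : ℝ} (hq : 0 < q)
    (hQ : pathControl y ε t ≤ ENNReal.ofReal q) :
    ENNReal.ofReal (1 / (2 * q * Real.exp 3 * g)) ≤ ENNReal.ofReal ε * pathIntegral y g ε t := by
  have hym := hy.measurable
  set S := ∫⁻ s in Ioc (t - 3 / ε) t, expENN (2 * (y t - y s)) with hS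
  have hSq : ENNReal.ofReal ε * S ≤ ENNReal.ofReal q := le_self_add.trans hQ
  have hgε : 1 / g ≤ 2 / ε := by
    rw [div_le_div_iff₀ hg hε]; linarith
  set ψ : ℝ → ℝ → ℝ≥0∞ := fun s r =>
    expENN (g * r - 2 * ε * (t - s) + -((y t - y s) + (y t - y (r + s)))) with hψ
  have hψm : Measurable (Function.uncurry ψ) := by
    simp only [hψ, Function.uncurry_def]; fun_prop
  set Rs := Ioc (t - 1 / ε) t with hRs
  set Rr := Ioc (-(1 / g)) 0 with hRr
  have hvs : volume Rs = ENNReal.ofReal (1 / ε) := by simp [hRs]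
  have hvr : volume Rr = ENNReal.ofReal (1 / g) := by simp [hRr]
  -- The choice l = 2q makes the left side, after integration and scaling by ε, equal to 4q/g, twice
  -- the error 2q/g. The discount costs at most e^3 on this rectangle.
  have hpt : ∀ s ∈ Rs, ∀ r ∈ Rr, ENNReal.ofReal (2 * (2 * q)) ≤
      ENNReal.ofReal ((2 * q) ^ 2) * expENN 3 * ψ s r +
        (expENN (2 * (y t - y s)) + expENN (2 * (y t - y (r + s)))) := by
    intro s hs r hr
    refine (ofReal_two_mul_le_expENN _ (y t - y s) (y t - y (r + s))).trans ?_
    refine add_le_add_left ?_ _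
    rw [mul_assoc]
    refine mul_le_mul_right ?_ _
    rw [hψ, ← expENN_add]
    refine expENN_mono ?_
    have h1 : -1 ≤ g * r := by
      have := mul_le_mul_of_nonneg_left hr.1.le hg.le
      have h : g * -(1 / g) = -1 := by field_simp
      linarith
    have h2 : ε * (t - s) ≤ 1 := by
      have := mul_le_mul_of_nonneg_left hs.1.le hε.le
      have h : ε * (t - 1 / ε) = ε * t - 1 := by field_simp
      linarith
    linarith
  have h1 : ∫⁻ s in Rs, ∫⁻ r in Rr, ψ s r ≤ pathIntegral y g ε t := by
    rw [pathIntegral_eq_lintegral_lintegral hy]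
    exact (lintegral_mono_set Ioc_subset_Iic_self).trans
      (lintegral_mono fun s => lintegral_mono_set Ioc_subset_Iic_self)
  have h2 : ∫⁻ s in Rs, ∫⁻ r in Rr, expENN (2 * (y t - y s)) ≤ ENNReal.ofReal (1 / g) * S := by
    simp only [setLIntegral_const, hvr]
    rw [lintegral_mul_const _ (by fun_prop), mul_comm]
    refine mul_le_mul_right (lintegral_mono_set (Ioc_subset_Ioc_left ?_)) _
    have : 1 / ε ≤ 3 / ε := by gcongr; norm_num
    linarith
  have h3 : ∫⁻ s in Rs, ∫⁻ r in Rr, expENN (2 * (y t - y (r + s))) ≤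
      ENNReal.ofReal (1 / g) * S := by
    rw [lintegral_lintegral_swap (by fun_prop)]
    calc _ ≤ ∫⁻ r in Rr, S := by
          refine setLIntegral_mono' measurableSet_Ioc fun r hr => ?_
          rw [hS, ← lintegral_indicator measurableSet_Ioc, ← lintegral_indicator measurableSet_Ioc,
            ← lintegral_add_left_eq_self
              ((Ioc (t - 3 / ε) t).indicator fun s => expENN (2 * (y t - y s))) r]
          refine lintegral_mono fun s => ?_
          by_cases hs : s ∈ Rs
          -- The window 3/ε in `pathControl` is 1/ε for s plus 1/g ≤ 2/ε for r.
          · have : r + s ∈ Ioc (t - 3 / ε) t := by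
              have := hs.1; have := hs.2; have := hr.1; have := hr.2
              have : 3 / ε = 1 / ε + 2 / ε := by ring
              constructor <;> linarith
            rw [indicator_of_mem hs, indicator_of_mem this]
          · rw [indicator_of_notMem hs]; exact zero_le
      _ = _ := by rw [setLIntegral_const, hvr, mul_comm]
  have key : ENNReal.ofReal (2 * (2 * q)) * ENNReal.ofReal (1 / g) * ENNReal.ofReal (1 / ε) ≤
      ENNReal.ofReal ((2 * q) ^ 2) * expENN 3 * pathIntegral y g ε t +
        (ENNReal.ofReal (1 / g) * S + ENNReal.ofReal (1 / g) * S) := by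
    calc _ = ∫⁻ s in Rs, ∫⁻ r in Rr, ENNReal.ofReal (2 * (2 * q)) := by
          simp only [setLIntegral_const, hvr, hvs]
      _ ≤ ∫⁻ s in Rs, ∫⁻ r in Rr, (ENNReal.ofReal ((2 * q) ^ 2) * expENN 3 * ψ s r +
        (expENN (2 * (y t - y s)) + expENN (2 * (y t - y (r + s))))) :=
          setLIntegral_mono' measurableSet_Ioc fun s hs =>
            setLIntegral_mono' measurableSet_Ioc fun r hr => hpt s hs r hr
      _ = ENNReal.ofReal ((2 * q) ^ 2) * expENN 3 * (∫⁻ s in Rs, ∫⁻ r in Rr, ψ s r) +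
          ((∫⁻ s in Rs, ∫⁻ r in Rr, expENN (2 * (y t - y s))) +
            ∫⁻ s in Rs, ∫⁻ r in Rr, expENN (2 * (y t - y (r + s)))) := by
          have hψs : ∀ s, Measurable (ψ s) := fun s => hψm.of_uncurry_left
          have hψi : Measurable fun s => ∫⁻ r in Rr, ψ s r :=
            Measurable.lintegral_prod_right hψm
          have hx : Measurable fun s => ∫⁻ _ in Rr, expENN (2 * (y t - y s)) :=
            by simp only [setLIntegral_const]; fun_prop
          rw [← lintegral_const_mul _ hψi, ← lintegral_add_left hx,
            ← lintegral_add_left (hψi.const_mul _)]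
          refine lintegral_congr fun s => ?_
          rw [lintegral_add_left ((hψs s).const_mul _), lintegral_add_left measurable_const,
            lintegral_const_mul _ (hψs s)]
      _ ≤ _ := add_le_add (mul_le_mul_right h1 _) (add_le_add h2 h3)
  have key2 : ENNReal.ofReal (4 * q / g) ≤ ENNReal.ofReal ((2 * q) ^ 2) * expENN 3 *
      (ENNReal.ofReal ε * pathIntegral y g ε t) + ENNReal.ofReal (2 * q / g) := by
    calc _ = ENNReal.ofReal ε * (ENNReal.ofReal (2 * (2 * q)) * ENNReal.ofReal (1 / g) *
          ENNReal.ofReal (1 / ε)) := by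
          rw [← ENNReal.ofReal_mul (by positivity), ← ENNReal.ofReal_mul (by positivity),
            ← ENNReal.ofReal_mul (by positivity)]
          congr 1; field_simp; ring
      _ ≤ _ := mul_le_mul_right key _
      _ = ENNReal.ofReal ((2 * q) ^ 2) * expENN 3 * (ENNReal.ofReal ε * pathIntegral y g ε t) +
          2 * ENNReal.ofReal (1 / g) * (ENNReal.ofReal ε * S) := by ring
      _ ≤ _ := by
          refine add_le_add_right ((mul_le_mul_right hSq _).trans_eq ?_) _
          rw [show (2 : ℝ≥0∞) = ENNReal.ofReal 2 by simp, ← ENNReal.ofReal_mul (by positivity),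
            ← ENNReal.ofReal_mul (by positivity)]
          congr 1; ring
  have key3 : ENNReal.ofReal (2 * q / g) ≤ ENNReal.ofReal ((2 * q) ^ 2) * expENN 3 *
      (ENNReal.ofReal ε * pathIntegral y g ε t) := by
    refine ENNReal.le_of_add_le_add_right (ENNReal.ofReal_ne_top (r := 2 * q / g)) ?_
    rw [← ENNReal.ofReal_add (by positivity) (by positivity)]
    refine le_trans (le_of_eq ?_) key2
    congr 1; ring
  have hpos : 0 < (2 * q) ^ 2 * Real.exp 3 := by positivity
  rw [expENN, ← ENNReal.ofReal_mul (by positivity)] at key3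
  refine (ENNReal.mul_le_mul_iff_right (a := ENNReal.ofReal ((2 * q) ^ 2 * Real.exp 3))
    (by simpa using hpos) ENNReal.ofReal_ne_top).1 ?_
  refine le_trans (le_of_eq ?_) key3
  rw [← ENNReal.ofReal_mul hpos.le]
  congr 1; field_simp

/-! ### Measurability and exponential moments. -/

section Modification

variable {Ω : Type u} [MeasurableSpace Ω] {P : Measure Ω}

/-- A process with almost surely continuous paths is indistinguishable from a measurable process
all of whose paths are continuous. -/
lemma exists_continuous_measurable_modification {W : ℝ → Ω → ℝ}
    (hW : ∀ t, AEMeasurable (W t) P) (hc : ∀ᵐ ω ∂P, Continuous fun t => W t ω) :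
    ∃ V : ℝ → Ω → ℝ, (∀ ω, Continuous fun t => V t ω) ∧ (∀ t, Measurable (V t)) ∧
      ∀ᵐ ω ∂P, ∀ t, V t ω = W t ω := by
  classical
  have hall : ∀ᵐ ω ∂P, (Continuous fun t => W t ω) ∧
      ∀ q : ℚ, W q ω = (hW q).mk (W q) ω :=
    hc.and (ae_all_iff.2 fun q => (hW q).ae_eq_mk)
  obtain ⟨N, hN, hNm, hN0⟩ := exists_measurable_superset_of_null hall
  have hgood : ∀ ω ∉ N, (Continuous fun t => W t ω) ∧
      ∀ q : ℚ, W q ω = (hW q).mk (W q) ω := fun ω hω => by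
    by_contra h
    exact hω (hN h)
  -- One null set serves all rational times; other times follow as limits by continuity.
  set V : ℝ → Ω → ℝ := fun t => Nᶜ.indicator (W t) with hV
  have hVc : ∀ ω, Continuous fun t => V t ω := fun ω => by
    by_cases hω : ω ∈ N
    · simpa [hV, hω] using continuous_const
    · simpa [hV, hω] using (hgood ω hω).1
  have hVq : ∀ q : ℚ, Measurable (V q) := fun q => by
    have : V q = Nᶜ.indicator ((hW q).mk (W q)) :=
      indicator_congr fun ω hω => (hgood ω hω).2 q
    rw [this]
    exact (hW q).measurable_mk.indicator hNm.compl
  refine ⟨V, hVc, fun t => ?_, ?_⟩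
  · obtain ⟨u, hu⟩ : ∃ u : ℕ → ℚ, Filter.Tendsto (fun n => (u n : ℝ)) Filter.atTop (nhds t) := by
      have ht : t ∈ closure (range ((↑) : ℚ → ℝ)) := Rat.isDenseEmbedding_coe_real.dense t
      obtain ⟨x, hx, hxt⟩ := mem_closure_iff_seq_limit.1 ht
      choose u hu using hx
      exact ⟨u, by simpa only [hu] using hxt⟩
    refine measurable_of_tendsto_metrizable (f := fun n => V (u n)) (fun n => hVq _) ?_
    exact tendsto_pi_nhds.2 fun ω => ((hVc ω).tendsto t).comp hu
  · have : ∀ᵐ ω ∂P, ω ∉ N := measure_eq_zero_iff_ae_notMem.1 hN0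
    filter_upwards [this] with ω hω t
    simp [hV, hω]

lemma lintegral_expENN_mul_of_hasLaw {X : Ω → ℝ} {v : ℝ} (hv : 0 ≤ v)
    (hX : HasLaw X (gaussianReal 0 v.toNNReal) P) (c : ℝ) :
    ∫⁻ ω, expENN (c * X ω) ∂P = expENN (c ^ 2 * v / 2) := by
  rw [hX.lintegral_comp (f := fun x => expENN (c * x)) (by fun_prop)]
  unfold expENN
  rw [← ofReal_integral_eq_lintegral_ofReal (integrable_exp_mul_gaussianReal c)
    (ae_of_all _ fun _ => (Real.exp_pos _).le)]
  have := congrFun (mgf_id_gaussianReal (μ := 0) (v := v.toNNReal)) c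
  simp only [mgf, id] at this
  rw [this, Real.coe_toNNReal _ hv]
  congr 2; ring

/-- The exponential moments of the increments, for a process with continuous paths, imply a bound
for the mean of `pathControl` which does not depend on the parameters. -/
lemma lintegral_pathControl_le [SFinite P] {V : ℝ → Ω → ℝ} (hVc : ∀ ω, Continuous fun t => V t ω)
    (hVm : ∀ t, Measurable (V t))
    (hexp : ∀ c s t : ℝ, s ≤ t → ∫⁻ ω, expENN (c * (V t ω - V s ω)) ∂P =
      expENN (c ^ 2 * (t - s) / 2)) {ε : ℝ} (hε : 0 < ε) (t : ℝ) :
    (Measurable fun ω => pathControl (fun s => √ε * V s ω) ε t) ∧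
    ∫⁻ ω, pathControl (fun s => √ε * V s ω) ε t ∂P ≤
      3 * expENN 6 + ((∑' k : ℕ, expENN (-(1 / 16 * k))) * expENN 2 +
        ∑' k : ℕ, expENN (-(1 / 2048 * k))) := by
  have hj : Measurable (Function.uncurry fun ω s => V s ω) :=
    (measurable_uncurry_of_continuous_of_measurable hVc hVm).comp measurable_swap
  have hσ : √ε ^ 2 = ε := Real.sq_sqrt hε.le
  have hexp' : ∀ c s t : ℝ, s ≤ t → ∫⁻ ω, expENN (c * (√ε * V t ω - √ε * V s ω)) ∂P =
      expENN (c ^ 2 * (ε * (t - s)) / 2) := fun c s t hst => by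
    have := hexp (c * √ε) s t hst
    rw [mul_pow, hσ] at this
    rw [show c ^ 2 * (ε * (t - s)) / 2 = c ^ 2 * ε * (t - s) / 2 by ring, ← this]
    refine lintegral_congr fun ω => ?_
    congr 1; ring
  have hjm : ∀ c u : ℝ, Measurable (Function.uncurry fun ω s =>
      expENN (c * (√ε * V u ω - √ε * V s ω))) := fun c u => by
    have h1 : Measurable fun p : Ω × ℝ => V p.2 p.1 := hj
    have h2 : Measurable fun p : Ω × ℝ => V u p.1 := (hVm u).comp measurable_fst
    simp only [Function.uncurry_def]
    exact measurable_expENN.comp (((h2.const_mul _).sub (h1.const_mul _)).const_mul _)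
  have hIm : ∀ c a b u : ℝ, Measurable fun ω => ∫⁻ s in Ioc a b,
      expENN (c * (√ε * V u ω - √ε * V s ω)) := fun c a b u =>
    Measurable.lintegral_prod_right (hjm c u)
  have hIle : ∀ c a b l : ℝ, ε * (b - a) ≤ l → ENNReal.ofReal ε *
      ∫⁻ ω, (∫⁻ s in Ioc a b, expENN (c * (√ε * V b ω - √ε * V s ω))) ∂P ≤
        ENNReal.ofReal l * expENN (c ^ 2 * l / 2) := fun c a b l hl => by
    rw [lintegral_lintegral_swap (hjm c b).aemeasurable]
    calc _ ≤ ENNReal.ofReal ε * ∫⁻ s in Ioc a b, expENN (c ^ 2 * l / 2) := by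
          refine mul_le_mul_right (setLIntegral_mono' measurableSet_Ioc fun s hs => ?_) _
          rw [hexp' c s b hs.2]
          refine expENN_mono ?_
          have : ε * (b - s) ≤ l :=
            (mul_le_mul_of_nonneg_left (by linarith [hs.1]) hε.le).trans hl
          have := mul_le_mul_of_nonneg_left this (sq_nonneg c)
          linarith
      _ = ENNReal.ofReal (ε * (b - a)) * expENN (c ^ 2 * l / 2) := by
          rw [setLIntegral_const, Real.volume_Ioc, ENNReal.ofReal_mul hε.le]; ring
      _ ≤ _ := mul_le_mul_left (ENNReal.ofReal_le_ofReal hl) _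
  have hm1 := (hIm 2 (t - 3 / ε) t t).const_mul (ENNReal.ofReal ε)
  have hm2 := fun k : ℕ => (hIm (-2) (t - (k + 1) / ε) (t - k / ε) (t - k / ε)).const_mul
    (ENNReal.ofReal ε * expENN (-(1 / 16 * k)))
  have hm3 : ∀ k : ℕ, Measurable fun ω => expENN (-(1 / 1024 * k)) *
      expENN (-(1 / 32) * (√ε * V t ω - √ε * V (t - k / ε) ω)) := fun k => by fun_prop
  have hm4 : ∀ k : ℕ, Measurable fun ω => ENNReal.ofReal ε * expENN (-(1 / 16 * k)) *
      (∫⁻ s in Ioc (t - (k + 1) / ε) (t - k / ε),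
        expENN (-2 * (√ε * V (t - k / ε) ω - √ε * V s ω))) +
      expENN (-(1 / 1024 * k)) * expENN (-(1 / 32) * (√ε * V t ω - √ε * V (t - k / ε) ω)) :=
    fun k => (hm2 k).add (hm3 k)
  simp only [pathControl]
  refine ⟨hm1.add (Measurable.tsum hm4), ?_⟩
  rw [lintegral_add_left hm1, lintegral_tsum fun k => (hm4 k).aemeasurable,
    ← ENNReal.tsum_mul_right, ← ENNReal.tsum_add]
  refine add_le_add ?_ (ENNReal.tsum_le_tsum fun k => ?_)
  · rw [lintegral_const_mul _ (hIm _ _ _ _)]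
    refine (hIle 2 _ _ 3 (le_of_eq (by field_simp; ring))).trans_eq ?_
    norm_num
  · rw [lintegral_add_left (hm2 k), lintegral_const_mul _ (hIm _ _ _ _),
      lintegral_const_mul _ (by fun_prop)]
    refine add_le_add ?_ ?_
    · rw [mul_comm (ENNReal.ofReal ε), mul_assoc]
      refine mul_le_mul_right ((hIle (-2) _ _ 1 (le_of_eq (by field_simp; ring))).trans_eq ?_) _
      norm_num
    · have : (k : ℝ) / ε ≥ 0 := by positivity
      rw [hexp' _ _ _ (by linarith), ← expENN_add]
      -- The moment contributes (1/32)² k / 2 = k/2048 against the weight -k/1024, leaving summable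
      -- decay.
      refine expENN_mono (le_of_eq ?_)
      field_simp; ring

end Modification

/-! ### From the integral to the steady state. -/

lemma randomSteadyState_eq {Ω : Type u} (W : ℝ → Ω → ℝ) (g α ε σ t : ℝ) (ω : Ω) :
    randomSteadyState W g α ε σ t ω =
      1 / (ENNReal.ofReal (2 * α) * pathIntegral (fun s => σ * W s ω) g ε t) ^ (1 / 2 : ℝ) := by
  simp only [randomSteadyState, pathIntegral, memoryTerm, forcingExponent, expENN, mul_sub,
    mul_assoc, mul_left_comm]

lemma one_div_rpow_half_mem {α ε A B : ℝ} (hα : 0 < α) (hε : 0 < ε) (hA : 0 < A) (hB : 0 < B)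
    {I : ℝ≥0∞} (hAI : ENNReal.ofReal A ≤ ENNReal.ofReal ε * I)
    (hIB : ENNReal.ofReal ε * I ≤ ENNReal.ofReal B) :
    ENNReal.ofReal (1 / √(2 * α * B) * √ε) ≤ 1 / (ENNReal.ofReal (2 * α) * I) ^ (1 / 2 : ℝ) ∧
      1 / (ENNReal.ofReal (2 * α) * I) ^ (1 / 2 : ℝ) ≤
        ENNReal.ofReal (1 / √(2 * α * A) * √ε) := by
  have hI : I ≠ ∞ := by
    rintro rfl
    rw [ENNReal.mul_top (by simpa using hε)] at hIB
    exact ENNReal.ofReal_ne_top (top_le_iff.1 hIB)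
  lift I to ℝ≥0 using hI
  rw [← ENNReal.ofReal_coe_nnreal, ← ENNReal.ofReal_mul hε.le] at hAI hIB
  have hAI' := (ENNReal.ofReal_le_ofReal_iff (by positivity)).1 hAI
  have hIB' := (ENNReal.ofReal_le_ofReal_iff hB.le).1 hIB
  set i : ℝ := (I : ℝ)
  have hi : 0 < i := by
    by_contra h
    nlinarith
  rw [← ENNReal.ofReal_coe_nnreal, ← ENNReal.ofReal_mul (by positivity),
    ENNReal.ofReal_rpow_of_pos (by positivity), ← Real.sqrt_eq_rpow, ← ENNReal.ofReal_one,
    ← ENNReal.ofReal_div_of_pos (by positivity)]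
  constructor <;> refine ENNReal.ofReal_le_ofReal ?_ <;>
    rw [one_div_mul_eq_div, div_le_div_iff₀ (by positivity) (by positivity), one_mul,
      ← Real.sqrt_mul (by positivity)] <;> refine Real.sqrt_le_sqrt ?_ <;> nlinarith

lemma randomSteadyState_zero {Ω : Type u} (W : ℝ → Ω → ℝ) {g α : ℝ} (hg : 0 < g) (hα : 0 < α)
    (t : ℝ) (ω : Ω) : randomSteadyState W g α 0 0 t ω = 0 := by
  have h : pathIntegral (fun s => 0 * W s ω) g 0 t = ∞ := by
    simp only [pathIntegral, zero_mul, sub_zero, add_zero, mul_zero, expENN_zero, mul_one,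
      setLIntegral_Iic_expENN_mul hg, setLIntegral_const, Real.volume_Iic]
    exact ENNReal.mul_top (by simpa using hg)
  rw [randomSteadyState_eq, h, ENNReal.mul_top (by simpa using hα)]
  simp

theorem lemmaD1 (g α χ : ℝ) (hg : 0 < g) (hα : 0 < α) (hχ : χ ∈ Ioo (0 : ℝ) 1) :
    ∃ c₁ c₂ : ℝ, 0 < c₁ ∧ 0 < c₂ ∧
      ∀ (Ω : Type u) [MeasurableSpace Ω] (P : Measure Ω) [IsProbabilityMeasure P]
        (W : ℝ → Ω → ℝ), IsTwoSidedBrownianMotion W P →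
        ∀ ε ∈ Icc (0 : ℝ) (2 * g), ∀ t : ℝ, 0 ≤ t →
          1 - χ ≤ P.real {ω |
            ENNReal.ofReal (c₁ * √ε) ≤ randomSteadyState W g α ε (√ε) t ω ∧
              randomSteadyState W g α ε (√ε) t ω ≤ ENNReal.ofReal (c₂ * √ε)} := by
  obtain ⟨hχ0, hχ1⟩ := hχ
  set C : ℝ≥0∞ := 3 * expENN 6 + ((∑' k : ℕ, expENN (-(1 / 16 * k))) * expENN 2 +
        ∑' k : ℕ, expENN (-(1 / 2048 * k))) with hC
  have hCtop : C ≠ ∞ := by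
    refine ENNReal.add_ne_top.2 ⟨ENNReal.mul_ne_top (by simp) (expENN_ne_top _),
      ENNReal.add_ne_top.2 ⟨ENNReal.mul_ne_top (tsum_expENN_neg_mul_ne_top (by norm_num))
        (expENN_ne_top _), tsum_expENN_neg_mul_ne_top (by norm_num)⟩⟩
  set q : ℝ := C.toReal / χ + 1 with hq
  have hq0 : 0 < q := by positivity
  have hCq : C / ENNReal.ofReal q ≤ ENNReal.ofReal χ := by
    rw [← ENNReal.ofReal_toReal hCtop, ← ENNReal.ofReal_div_of_pos hq0]
    refine ENNReal.ofReal_le_ofReal ?_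
    rw [div_le_iff₀ hq0, hq, mul_add, mul_div_cancel₀ _ hχ0.ne']
    linarith
  set B' : ℝ≥0∞ := ENNReal.ofReal (4 / g) *
    (ENNReal.ofReal q ^ 65 * ∑' k : ℕ, expENN (-(1 / 8 * k))) with hB'
  have hB'top : B' ≠ ∞ := ENNReal.mul_ne_top ENNReal.ofReal_ne_top
    (ENNReal.mul_ne_top (by simp) (tsum_expENN_neg_mul_ne_top (by norm_num)))
  set B : ℝ := B'.toReal + 1 with hB
  have hB0 : 0 < B := by positivity
  have hBB : B' ≤ ENNReal.ofReal B := by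
    rw [← ENNReal.ofReal_toReal hB'top]
    exact ENNReal.ofReal_le_ofReal (by linarith)
  set A : ℝ := 1 / (2 * q * Real.exp 3 * g) with hA
  have hA0 : 0 < A := by positivity
  refine ⟨1 / √(2 * α * B), 1 / √(2 * α * A), by positivity, by positivity, ?_⟩
  intro Ω _ P _ W hW ε hε t _
  rcases hε.1.eq_or_lt with rfl | hε0
  · simp [randomSteadyState_zero W hg hα, hχ0.le]
  have hWm : ∀ t, AEMeasurable (W t) P := fun t => by
    rcases le_total 0 t with h | h
    · refine (hW.law_increment 0 t h).aemeasurable.congr ?_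
      filter_upwards [hW.zero_at_zero] with ω hω
      simp [hω]
    · refine (hW.law_increment t 0 h).aemeasurable.neg.congr ?_
      filter_upwards [hW.zero_at_zero] with ω hω
      simp [hω]
  obtain ⟨V, hVc, hVm, hVW⟩ := exists_continuous_measurable_modification hWm hW.continuous_paths
  have hexp : ∀ c s t : ℝ, s ≤ t → ∫⁻ ω, expENN (c * (V t ω - V s ω)) ∂P =
      expENN (c ^ 2 * (t - s) / 2) := fun c s t hst =>
    lintegral_expENN_mul_of_hasLaw (X := fun ω => V t ω - V s ω) (by linarith)
      ((hW.law_increment s t hst).congr (by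
        filter_upwards [hVW] with ω hω; simp [hω])) c
  obtain ⟨hZm, hZ⟩ := lintegral_pathControl_le hVc hVm hexp hε0 t
  have hbad : P {ω | ENNReal.ofReal q ≤ pathControl (fun s => √ε * V s ω) ε t} ≤
      ENNReal.ofReal χ := by
    refine (meas_ge_le_lintegral_div hZm.aemeasurable (by simpa using hq0)
      ENNReal.ofReal_ne_top).trans ?_
    exact (ENNReal.div_le_div_right hZ _).trans hCq
  set G := {ω | ENNReal.ofReal (1 / √(2 * α * B) * √ε) ≤ randomSteadyState W g α ε (√ε) t ω ∧
    randomSteadyState W g α ε (√ε) t ω ≤ ENNReal.ofReal (1 / √(2 * α * A) * √ε)} with hG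
  have hsub : ∀ᵐ ω ∂P, ω ∈ Gᶜ →
      ω ∈ {ω | ENNReal.ofReal q ≤ pathControl (fun s => √ε * V s ω) ε t} := by
    filter_upwards [hVW] with ω hω hωG
    by_contra hlt
    have hle : pathControl (fun s => √ε * V s ω) ε t ≤ ENNReal.ofReal q := (not_le.1 hlt).le
    have hy : Continuous fun s => √ε * V s ω := continuous_const.mul (hVc ω)
    refine hωG ?_
    rw [hG, mem_ofPred_eq, randomSteadyState_eq]
    simp only [← hω]
    exact one_div_rpow_half_mem hα hε0 hA0 hB0
      (le_ofReal_mul_pathIntegral hy hg hε0 hε.2 t hq0 hle)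
      ((ofReal_mul_pathIntegral_le hy hg hε0 hε.2 t hle).trans hBB)
  have hGc : P.real Gᶜ ≤ χ :=
    ENNReal.toReal_le_of_le_ofReal hχ0.le ((measure_mono_ae hsub).trans hbad)
  -- Subadditivity suffices, so `G`, defined through `W` rather than `V`, need not be measurable.
  have huniv : (1 : ℝ) ≤ P.real G + P.real Gᶜ := by
    rw [← probReal_univ (μ := P), ← union_compl_self G]
    exact measureReal_union_le _ _
  linarith
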